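/- Let $E=(E^0,E^1,r,s)$ be an arbitrary directed graph, i.e. two sets $E^0$ (vertices) and $E^1$ (edges) of any cardinality with maps $r,s:E^1\to E^0$, and let $K$ be a field. Let $\mathcal L_K(E)$ be the Leavitt path algebra of $E$: the (not necessarily unital) associative $K$-algebra generated by $\{v\mid v\in E^0\}\cup\{\alpha,\alpha^*\mid \alpha\in E^1\}$ subject to the relations (1) $vw=\delta_{v,w}\,v$ for all $v,w\in E^0$; (2) $s(\alpha)\alpha=\alpha\, r(\alpha)=\alpha$ and $r(\alpha)\alpha^*=\alpha^*s(\alpha)=\alpha^*$ for all $\alpha\in E^1$; (3) $\alpha^*\beta=\delta_{\alpha,\beta}\,r(\alpha)$ for all $\alpha,\beta\in E^1$; (4) $\sum_{\alpha\in s^{-1}(v)}\alpha\alpha^*=v$ for every $v\in E^0$ such that $s^{-1}(v)$ is finite and non-empty. For $k\in\mathbb Z$ let $\mathcal L_K(E)_k$ be the $K$-span of the words in the generators of degree $k$, where $\deg v=0$, $\deg\alpha=1$ and $\deg\alpha^*=-1$. Then $\mathcal L_K(E)$, with this canonical $\mathbb Z$-grading, is a graded von Neumann regular ring: $\mathcal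 L_K(E)=\bigoplus_{k\in\mathbb Z}\mathcal L_K(E)_k$ with $\mathcal L_K(E)_k\,\mathcal L_K(E)_l\subseteq\mathcal L_K(E)_{k+l}$ for all $k,l\in\mathbb Z$, and for every homogeneous $x\in\mathcal L_K(E)$ there is $y\in\mathcal L_K(E)$ with $xyx=x$. -/

import Mathlib

/-- A directed graph `E = (E⁰, E¹, r, s)` with set of vertices `V = E⁰`, set of edges `A = E¹`
(both of arbitrary cardinality), source map `src` and range map `rng`. -/
structure DirectedGraph (V : Type*) (A : Type*) where
  /-- the source of an edge -/
  src : A → V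
  /-- the range of an edge -/
  rng : A → V

namespace DirectedGraph

/-- The edges emitted by the vertex `v`. -/
def emitted {V A : Type*} (E : DirectedGraph V A) (v : V) : Set A := {e | E.src e = v}

end DirectedGraph

namespace LeavittPathAlgebra

/-- The generators: vertices `v`, edges `e` and ghost edges `e*`. -/
inductive Generator (V : Type*) (A : Type*)
  | vertex (v : V) : Generator V A
  | edge (e : A) : Generator V A
  | ghost (e : A) : Generator V A

/-- The free associative (non-unital) `K`-algebra on the generators: the semigroup algebra of the
semigroup of nonempty words. -/
abbrev FreeAlg (K V A : Type*) [Field K] : Type _ :=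
  MonoidAlgebra K (FreeSemigroup (Generator V A))

/-- A nonempty word as an element of the free algebra. -/
noncomputable def word (K : Type*) {V A : Type*} [Field K] (w : FreeSemigroup (Generator V A)) :
    FreeAlg K V A :=
  MonoidAlgebra.single w 1

/-- The vertex `v` in the free algebra. -/
noncomputable def vert (K : Type*) {V : Type*} (A : Type*) [Field K] (v : V) : FreeAlg K V A :=
  word K (FreeSemigroup.of (Generator.vertex v))

/-- The edge `e` in the free algebra. -/
noncomputable def edge (K V : Type*) {A : Type*} [Field K] (e : A) : FreeAlg K V A :=
  word K (FreeSemigroup.of (Generator.edge e))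

/-- The ghost edge `e*` in the free algebra. -/
noncomputable def ghost (K V : Type*) {A : Type*} [Field K] (e : A) : FreeAlg K V A :=
  word K (FreeSemigroup.of (Generator.ghost e))

/-- The defining relations. -/
inductive Rel {V A : Type*} (E : DirectedGraph V A) (K : Type*) [Field K] :
    FreeAlg K V A → FreeAlg K V A → Prop
  | vert_mul_self (v : V) : Rel E K (vert K A v * vert K A v) (vert K A v)
  | vert_mul_vert (v w : V) (h : v ≠ w) : Rel E K (vert K A v * vert K A w) 0
  | src_mul_edge (e : A) : Rel E K (vert K A (E.src e) * edge K V e) (edge K V e)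
  | edge_mul_rng (e : A) : Rel E K (edge K V e * vert K A (E.rng e)) (edge K V e)
  | rng_mul_ghost (e : A) : Rel E K (vert K A (E.rng e) * ghost K V e) (ghost K V e)
  | ghost_mul_src (e : A) : Rel E K (ghost K V e * vert K A (E.src e)) (ghost K V e)
  | ghost_mul_edge_self (e : A) : Rel E K (ghost K V e * edge K V e) (vert K A (E.rng e))
  | ghost_mul_edge (e f : A) (h : e ≠ f) : Rel E K (ghost K V e * edge K V f) 0
  | sum_edge_mul_ghost (v : V) (hfin : (E.emitted v).Finite) (hne : (E.emitted v).Nonempty) :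
      Rel E K (∑ e ∈ hfin.toFinset, edge K V e * ghost K V e) (vert K A v)

/-- The `K`-algebra congruence generated by the relations. As the free algebra has no unit, the
scalar multiples of the relations are put in explicitly. -/
noncomputable def con {V A : Type*} (E : DirectedGraph V A) (K : Type*) [Field K] : RingCon (FreeAlg K V A) :=
  ringConGen fun x y => ∃ (c : K) (a b : FreeAlg K V A), Rel E K a b ∧ x = c • a ∧ y = c • b

theorem con_smul {V A : Type*} (E : DirectedGraph V A) (K : Type*) [Field K] (c : K)
    {x y : FreeAlg K V A} (h : con E K x y) : con E K (c • x) (c • y) := by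
  have h' : RingConGen.Rel
      (fun x y => ∃ (c : K) (a b : FreeAlg K V A), Rel E K a b ∧ x = c • a ∧ y = c • b) x y := h
  induction h' with
  | of x y hxy =>
    obtain ⟨d, a, b, hab, rfl, rfl⟩ := hxy
    exact RingConGen.Rel.of _ _ ⟨c * d, a, b, hab, smul_smul c d a, smul_smul c d b⟩
  | refl x => exact (con E K).refl _
  | symm hxy ih => exact (con E K).symm (ih hxy)
  | trans hxy hyz ih₁ ih₂ => exact (con E K).trans (ih₁ hxy) (ih₂ hyz)
  | add hxy hzw ih₁ ih₂ =>
    rw [smul_add, smul_add]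
    exact (con E K).add (ih₁ hxy) (ih₂ hzw)
  | mul hxy hzw ih₁ ih₂ =>
    rw [← smul_mul_assoc, ← smul_mul_assoc]
    exact (con E K).mul (ih₁ hxy) hzw

end LeavittPathAlgebra

/-- The Leavitt path algebra `L_K(E)` (in general without a unit). -/
def LeavittPathAlgebra {V A : Type*} (E : DirectedGraph V A) (K : Type*) [Field K] : Type _ :=
  (LeavittPathAlgebra.con E K).Quotient

namespace LeavittPathAlgebra

noncomputable instance {V A : Type*} (E : DirectedGraph V A) (K : Type*) [Field K] :
    NonUnitalRing (LeavittPathAlgebra E K) :=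
  inferInstanceAs (NonUnitalRing (con E K).Quotient)

/-- The quotient map from the free algebra. -/
noncomputable def mk {V A : Type*} (E : DirectedGraph V A) (K : Type*) [Field K] (x : FreeAlg K V A) :
    LeavittPathAlgebra E K :=
  RingCon.toQuotient x

theorem mk_surjective {V A : Type*} (E : DirectedGraph V A) (K : Type*) [Field K] :
    Function.Surjective (mk E K) :=
  Quotient.mk_surjective

theorem mk_add {V A : Type*} (E : DirectedGraph V A) (K : Type*) [Field K]
    (x y : FreeAlg K V A) : mk E K (x + y) = mk E K x + mk E K y := rfl

theorem mk_mul {V A : Type*} (E : DirectedGraph V A) (K : Type*) [Field K]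
    (x y : FreeAlg K V A) : mk E K (x * y) = mk E K x * mk E K y := rfl

theorem mk_zero {V A : Type*} (E : DirectedGraph V A) (K : Type*) [Field K] :
    mk E K 0 = 0 := rfl

noncomputable instance {V A : Type*} (E : DirectedGraph V A) (K : Type*) [Field K] :
    SMul K (LeavittPathAlgebra E K) where
  smul c := Quotient.map' (c • ·) fun _ _ h => con_smul E K c h

theorem mk_smul {V A : Type*} (E : DirectedGraph V A) (K : Type*) [Field K] (c : K)
    (x : FreeAlg K V A) : mk E K (c • x) = c • mk E K x := rfl

noncomputable instance {V A : Type*} (E : DirectedGraph V A) (K : Type*) [Field K] :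
    Module K (LeavittPathAlgebra E K) where
  one_smul x := by
    obtain ⟨x, rfl⟩ := mk_surjective E K x
    rw [← mk_smul, one_smul]
  mul_smul c d x := by
    obtain ⟨x, rfl⟩ := mk_surjective E K x
    simp only [← mk_smul, mul_smul]
  smul_zero c := by
    rw [← mk_zero, ← mk_smul, smul_zero]
  smul_add c x y := by
    obtain ⟨x, rfl⟩ := mk_surjective E K x
    obtain ⟨y, rfl⟩ := mk_surjective E K y
    simp only [← mk_smul, ← mk_add, smul_add]
  add_smul c d x := by
    obtain ⟨x, rfl⟩ := mk_surjective E K x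
    simp only [← mk_smul, ← mk_add, add_smul]
  zero_smul x := by
    obtain ⟨x, rfl⟩ := mk_surjective E K x
    rw [← mk_zero, ← mk_smul, zero_smul]

instance {V A : Type*} (E : DirectedGraph V A) (K : Type*) [Field K] :
    IsScalarTower K (LeavittPathAlgebra E K) (LeavittPathAlgebra E K) where
  smul_assoc c x y := by
    obtain ⟨x, rfl⟩ := mk_surjective E K x
    obtain ⟨y, rfl⟩ := mk_surjective E K y
    simp only [smul_eq_mul, ← mk_smul, ← mk_mul, smul_mul_assoc]

instance {V A : Type*} (E : DirectedGraph V A) (K : Type*) [Field K] :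
    SMulCommClass K (LeavittPathAlgebra E K) (LeavittPathAlgebra E K) where
  smul_comm c x y := by
    obtain ⟨x, rfl⟩ := mk_surjective E K x
    obtain ⟨y, rfl⟩ := mk_surjective E K y
    simp only [smul_eq_mul, ← mk_smul, ← mk_mul, mul_smul_comm]

/-- The degrees of the generators: `deg v = 0`, `deg e = 1`, `deg e* = -1`. -/
def Generator.degree {V A : Type*} : Generator V A → ℤ
  | vertex _ => 0
  | edge _ => 1
  | ghost _ => -1

/-- The degree of a nonempty word: the sum of the degrees of its letters. -/
def wordDegree {V A : Type*} (w : FreeSemigroup (Generator V A)) : ℤ :=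
  (FreeSemigroup.lift (fun g : Generator V A => Multiplicative.ofAdd g.degree) w).toAdd

/-- The component of degree `k` in the canonical `ℤ`-grading of `L_K(E)`: the `K`-span of the
(classes of) words of degree `k`. -/
noncomputable def component {V A : Type*} (E : DirectedGraph V A) (K : Type*) [Field K] (k : ℤ) :
    Submodule K (LeavittPathAlgebra E K) :=
  Submodule.span K {x | ∃ w : FreeSemigroup (Generator V A), wordDegree w = k ∧ x = mk E K (word K w)}

end LeavittPathAlgebra

/-- `R` is a graded ring (possibly without unit) with homogeneous components `𝒜 γ`: it is their
direct sum as an additive group, and `𝒜 γ * 𝒜 δ ⊆ 𝒜 (γ + δ)`. -/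
structure IsRingGrading {Γ R σ : Type*} [AddCommGroup Γ] [DecidableEq Γ] [NonUnitalRing R]
    [SetLike σ R] [AddSubgroupClass σ R] (𝒜 : Γ → σ) : Prop where
  isInternal : DirectSum.IsInternal 𝒜
  mul_mem : ∀ (γ δ : Γ) (x y : R), x ∈ 𝒜 γ → y ∈ 𝒜 δ → x * y ∈ 𝒜 (γ + δ)

/-- `R`, with homogeneous components `𝒜 γ`, is a graded von Neumann regular ring. -/
structure IsGradedVonNeumannRegular {Γ R σ : Type*} [AddCommGroup Γ] [DecidableEq Γ]
    [NonUnitalRing R] [SetLike σ R] [AddSubgroupClass σ R] (𝒜 : Γ → σ) : Prop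
    extends IsRingGrading 𝒜 where
  regular : ∀ (γ : Γ) (x : R), x ∈ 𝒜 γ → ∃ y : R, x * y * x = x

/-!
The grading. Both sides of each defining relation are homogeneous of the same degree, so the
projections of the free algebra onto the spans of the words of a given degree respect the
congruence generated by the relations (`mk_freeProj_eq_of_con`) and descend to `L_K(E)`. These
projections separate the components, which is the independence part of the direct sum.

Regularity. With the relations `e* f = δ_{e,f} r(e)`, every word is zero or a monomial `α β*`, where
`α` and `β` are paths with the same range. A homogeneous element of degree `k` is a combination of
finitely many of them, so it involves only a finite set `F` of edges and paths `β` of length at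
most some `n`. Put `q_v = v - ∑ e e*`, summed over the edges `e ∈ F` emitted by `v`. Repeated
use of `α β* = α q_v β* + ∑ (α e) (β e)*` turns the element into a combination of

* `α q_v β*` with `β` of length less than `n`, and
* `α β*` with `β` of length `n`,

all with `|α| = |β| + k` and edges in `F` (`pathElt_mul_ghostElt_mem_unitSpan`). As `q_v e = 0` and
`e* q_v = 0` for `e ∈ F`, the product of `β*` and `γ` between the corresponding idempotents vanishes
unless `β = γ` (`core_mul_ghostElt_mul_pathElt_mul_core`). So these elements, together with the
elements `β q α*` of degree `-k`, multiply like the matrix units of a block matrix algebra over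
`K`, with one block for each pair of a vertex and a length. The element is thus encoded by a
rectangular block matrix `M` over a field, and a generalized inverse `N`, with `M N M = M`, gives
the required `y` (`exists_mul_mul_eq_self_of_mem_span`).
-/

namespace LeavittPathAlgebra

variable {V A : Type*} (E : DirectedGraph V A) (K : Type*) [Field K]

/-! ### The canonical grading -/

/-- The quotient map from the free algebra, as a `K`-linear map. -/
noncomputable def mkLinear : FreeAlg K V A →ₗ[K] LeavittPathAlgebra E K where
  toFun := mk E K
  map_add' := mk_add E K
  map_smul' := mk_smul E K

theorem mkLinear_apply (x : FreeAlg K V A) : mkLinear E K x = mk E K x := rfl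

theorem mk_eq_mk_iff {x y : FreeAlg K V A} : mk E K x = mk E K y ↔ con E K x y :=
  (con E K).eq

theorem mk_eq_of_rel {x y : FreeAlg K V A} (h : Rel E K x y) : mk E K x = mk E K y :=
  (mk_eq_mk_iff E K).2 <|
    RingConGen.Rel.of _ _ ⟨1, x, y, h, (one_smul K x).symm, (one_smul K y).symm⟩

theorem wordDegree_mul (w w' : FreeSemigroup (Generator V A)) :
    wordDegree (w * w') = wordDegree w + wordDegree w' := by
  simp [wordDegree]

theorem word_mul_word (w w' : FreeSemigroup (Generator V A)) :
    word K w * word K w' = word K (w * w') := by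
  simp [word, MonoidAlgebra.single_mul_single]

theorem smul_word (c : K) (w : FreeSemigroup (Generator V A)) :
    c • word K w = MonoidAlgebra.single w c := by
  simp [word, MonoidAlgebra.smul_single]

variable {K} in
theorem freeAlg_induction {p : FreeAlg K V A → Prop} (x : FreeAlg K V A) (zero : p 0)
    (add : ∀ x y, p x → p y → p (x + y)) (smul : ∀ (c : K) x, p x → p (c • x))
    (wd : ∀ w, p (word K w)) : p x := by
  induction x using MonoidAlgebra.induction_linear with
  | zero => exact zero
  | add x y hx hy => exact add x y hx hy
  | single w c => rw [← smul_word]; exact smul c _ (wd w)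

/-- The projection of the free algebra onto its component of degree `k`, which deletes all words
of a degree other than `k`. -/
noncomputable def freeProj (k : ℤ) : FreeAlg K V A →ₗ[K] FreeAlg K V A where
  toFun x := .ofCoeff (x.coeff.filter fun w => wordDegree w = k)
  map_add' x y := by rw [MonoidAlgebra.coeff_add, Finsupp.filter_add, MonoidAlgebra.ofCoeff_add]
  map_smul' c x := by
    rw [MonoidAlgebra.coeff_smul, Finsupp.filter_smul, MonoidAlgebra.ofCoeff_smul, RingHom.id_apply]

theorem freeProj_word (k : ℤ) (w : FreeSemigroup (Generator V A)) :
    freeProj K k (word K w) = if wordDegree w = k then word K w else 0 := by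
  simp only [freeProj, word, LinearMap.coe_mk, AddHom.coe_mk, MonoidAlgebra.coeff_single]
  split_ifs with h
  · rw [Finsupp.filter_single_of_pos (fun w => wordDegree w = k) h]; rfl
  · rw [Finsupp.filter_single_of_neg (fun w => wordDegree w = k) h]; rfl

theorem freeProj_freeProj_mul (i k : ℤ) (x y : FreeAlg K V A) :
    freeProj K k (freeProj K i x * y) = freeProj K i x * freeProj K (k - i) y := by
  induction x using freeAlg_induction with
  | zero => simp
  | add x x' hx hx' => simp [add_mul, hx, hx']
  | smul c x hx => rw [map_smul, smul_mul_assoc, map_smul, hx, smul_mul_assoc]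
  | wd w =>
    induction y using freeAlg_induction with
    | zero => simp
    | add x x' hx hx' => simp [mul_add, hx, hx']
    | smul c x hx => rw [map_smul, mul_smul_comm, mul_smul_comm, map_smul, hx]
    | wd w' =>
      by_cases hi : wordDegree w = i
      · have : wordDegree (w * w') = k ↔ wordDegree w' = k - i := by
          rw [wordDegree_mul, hi]; omega
        simp only [freeProj_word, if_pos hi, word_mul_word, this, mul_ite, mul_zero]
      · simp [freeProj_word, if_neg hi]

theorem sum_freeProj (x : FreeAlg K V A) {S : Finset ℤ}
    (hS : x.coeff.support.image wordDegree ⊆ S) : ∑ i ∈ S, freeProj K i x = x := by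
  ext w
  simp only [freeProj, LinearMap.coe_mk, AddHom.coe_mk, MonoidAlgebra.coeff_sum,
    Finsupp.finsetSum_apply, Finsupp.filter_apply, Finset.sum_ite_eq]
  split_ifs with h
  · rfl
  · by_contra hw
    exact h (hS (Finset.mem_image_of_mem _ (Finsupp.mem_support_iff.2 (Ne.symm hw))))

theorem freeProj_mul (k : ℤ) (x y : FreeAlg K V A) {S : Finset ℤ}
    (hS : x.coeff.support.image wordDegree ⊆ S) :
    freeProj K k (x * y) = ∑ i ∈ S, freeProj K i x * freeProj K (k - i) y := by
  conv_lhs => rw [← sum_freeProj K x hS]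
  simp only [Finset.sum_mul, map_sum, freeProj_freeProj_mul]

variable {K} in
/-- An element of the free algebra is homogeneous of degree `k` if only words of degree `k` occur
in it. -/
def IsFreeHomogeneous (k : ℤ) (x : FreeAlg K V A) : Prop :=
  ∀ i, freeProj K i x = if k = i then x else 0

theorem isFreeHomogeneous_word {k : ℤ} {w : FreeSemigroup (Generator V A)} (h : wordDegree w = k) :
    IsFreeHomogeneous k (word K w) := fun i => by rw [freeProj_word, h]

theorem isFreeHomogeneous_zero (k : ℤ) : IsFreeHomogeneous k (0 : FreeAlg K V A) := fun i => by
  simp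

theorem IsFreeHomogeneous.sum {ι : Type*} (s : Finset ι) {k : ℤ} {x : ι → FreeAlg K V A}
    (h : ∀ j ∈ s, IsFreeHomogeneous k (x j)) : IsFreeHomogeneous k (∑ j ∈ s, x j) := fun i => by
  rw [map_sum, Finset.sum_congr rfl fun j hj => h j hj i]
  split_ifs <;> simp

/-- Both sides of a defining relation are homogeneous of the same degree. -/
theorem Rel.exists_isFreeHomogeneous {x y : FreeAlg K V A} (h : Rel E K x y) :
    ∃ k, IsFreeHomogeneous k x ∧ IsFreeHomogeneous k y := by
  cases h <;>
    simp only [vert, edge, ghost, word_mul_word]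
  case vert_mul_vert => exact ⟨0, isFreeHomogeneous_word K rfl, isFreeHomogeneous_zero K 0⟩
  case ghost_mul_edge => exact ⟨0, isFreeHomogeneous_word K rfl, isFreeHomogeneous_zero K 0⟩
  case sum_edge_mul_ghost =>
    exact ⟨0, .sum K _ fun _ _ => isFreeHomogeneous_word K rfl, isFreeHomogeneous_word K rfl⟩
  all_goals exact ⟨_, isFreeHomogeneous_word K rfl, isFreeHomogeneous_word K rfl⟩

theorem mk_freeProj_eq_of_con (k : ℤ) {x y : FreeAlg K V A} (h : con E K x y) :
    mk E K (freeProj K k x) = mk E K (freeProj K k y) := by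
  classical
  have h' : RingConGen.Rel
      (fun x y => ∃ (c : K) (a b : FreeAlg K V A), Rel E K a b ∧ x = c • a ∧ y = c • b) x y := h
  clear h
  induction h' generalizing k with
  | of x y hxy =>
    obtain ⟨c, a, b, hab, rfl, rfl⟩ := hxy
    obtain ⟨i, ha, hb⟩ := Rel.exists_isFreeHomogeneous E K hab
    rw [map_smul, map_smul, mk_smul, mk_smul, ha, hb]
    split_ifs
    · rw [mk_eq_of_rel E K hab]
    · rfl
  | refl => rfl
  | symm _ ih => exact (ih k).symm
  | trans _ _ ih₁ ih₂ => exact (ih₁ k).trans (ih₂ k)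
  | add _ _ ih₁ ih₂ => rw [map_add, map_add, mk_add, mk_add, ih₁, ih₂]
  | @mul a b c d _ _ ih₁ ih₂ =>
    -- the two left factors need not have the same support, so sum over the union of the degrees
    rw [freeProj_mul K k a c (Finset.subset_union_left (s₂ := b.coeff.support.image wordDegree)),
      freeProj_mul K k b d (Finset.subset_union_right (s₁ := a.coeff.support.image wordDegree))]
    simp only [← mkLinear_apply, map_sum]
    simp only [mkLinear_apply, mk_mul, ih₁, ih₂]

/-- The projection of `L_K(E)` onto its component of degree `k`. It is well defined because both
sides of each defining relation are homogeneous of the same degree. -/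
noncomputable def proj (k : ℤ) : LeavittPathAlgebra E K →ₗ[K] LeavittPathAlgebra E K where
  toFun := Quotient.lift (fun x => mk E K (freeProj K k x)) fun _ _ h =>
    mk_freeProj_eq_of_con E K k h
  map_add' x y := by
    obtain ⟨x, rfl⟩ := mk_surjective E K x
    obtain ⟨y, rfl⟩ := mk_surjective E K y
    exact congrArg (mk E K) (map_add (freeProj K k) x y)
  map_smul' c x := by
    obtain ⟨x, rfl⟩ := mk_surjective E K x
    exact congrArg (mk E K) (map_smul (freeProj K k) c x)

theorem proj_mk (k : ℤ) (x : FreeAlg K V A) :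
    proj E K k (mk E K x) = mk E K (freeProj K k x) := rfl

theorem proj_eq_self {k : ℤ} {x : LeavittPathAlgebra E K} (hx : x ∈ component E K k) :
    proj E K k x = x := by
  change x ∈ LinearMap.eqLocus (proj E K k) LinearMap.id
  refine Submodule.span_le.2 ?_ hx
  rintro _ ⟨w, hw, rfl⟩
  change proj E K k _ = _
  rw [proj_mk, freeProj_word, if_pos hw]
  rfl

theorem component_le_ker_proj {k l : ℤ} (h : l ≠ k) :
    component E K l ≤ LinearMap.ker (proj E K k) := by
  refine Submodule.span_le.2 ?_
  rintro _ ⟨w, hw, rfl⟩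
  change proj E K k _ = 0
  rw [proj_mk, freeProj_word, if_neg (hw.trans_ne h), mk_zero]

theorem mk_word_mem_component (w : FreeSemigroup (Generator V A)) :
    mk E K (word K w) ∈ component E K (wordDegree w) :=
  Submodule.subset_span ⟨w, rfl, rfl⟩

theorem iSup_component : ⨆ k, component E K k = ⊤ := by
  refine eq_top_iff.2 fun x _ => ?_
  obtain ⟨x, rfl⟩ := mk_surjective E K x
  induction x using freeAlg_induction with
  | zero => exact Submodule.zero_mem _
  | add x y hx hy => exact Submodule.add_mem _ (hx trivial) (hy trivial)
  | smul c x hx => exact Submodule.smul_mem _ c (hx trivial)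
  | wd w => exact Submodule.mem_iSup_of_mem _ (mk_word_mem_component E K w)

theorem iSupIndep_component : iSupIndep (component E K) := by
  rw [iSupIndep_def]
  intro k
  have hle : ⨆ (l) (_ : l ≠ k), component E K l ≤ LinearMap.ker (proj E K k) :=
    iSup₂_le fun l hl => component_le_ker_proj E K hl
  refine Submodule.disjoint_def.2 fun x hx hx' => ?_
  rw [← proj_eq_self E K hx, LinearMap.mem_ker.1 (hle hx')]

theorem mul_mem_component {k l : ℤ} {x y : LeavittPathAlgebra E K} (hx : x ∈ component E K k)
    (hy : y ∈ component E K l) : x * y ∈ component E K (k + l) := by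
  induction hx using Submodule.span_induction with
  | zero => rw [zero_mul]; exact Submodule.zero_mem _
  | add x x' _ _ hx hx' => rw [add_mul]; exact Submodule.add_mem _ hx hx'
  | smul c x _ hx => rw [smul_mul_assoc]; exact Submodule.smul_mem _ c hx
  | mem x hx =>
    obtain ⟨w, rfl, rfl⟩ := hx
    induction hy using Submodule.span_induction with
    | zero => rw [mul_zero]; exact Submodule.zero_mem _
    | add y y' _ _ hy hy' => rw [mul_add]; exact Submodule.add_mem _ hy hy'
    | smul c y _ hy => rw [mul_smul_comm]; exact Submodule.smul_mem _ c hy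
    | mem y hy =>
      obtain ⟨w', rfl, rfl⟩ := hy
      rw [← mk_mul, word_mul_word, ← wordDegree_mul]
      exact mk_word_mem_component E K _

/-- The components form a grading of the ring `L_K(E)`. -/
theorem isRingGrading_component : IsRingGrading (component E K) where
  isInternal := DirectSum.isInternal_submodule_of_iSupIndep_of_iSup_eq_top
    (iSupIndep_component E K) (iSup_component E K)
  mul_mem _ _ _ _ hx hy := mul_mem_component E K hx hy

end LeavittPathAlgebra

/-! ### Systems of matrix units over a field -/

/-- Matrices over a field have generalized inverses. -/
theorem Matrix.exists_mul_mul_eq_self {P Q K : Type*} [Fintype P] [Fintype Q] [Field K]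
    (M : Matrix P Q K) : ∃ N : Matrix Q P K, M * N * M = M := by
  classical
  obtain ⟨g₀, hg₀⟩ := M.toLin'.rangeRestrict.exists_rightInverse_of_surjective
    M.toLin'.range_rangeRestrict
  obtain ⟨g, hg⟩ := LinearMap.exists_extend g₀
  refine ⟨LinearMap.toMatrix' g, Matrix.toLin'.injective ?_⟩
  rw [Matrix.toLin'_mul, Matrix.toLin'_mul, Matrix.toLin'_toMatrix']
  refine LinearMap.ext fun x => ?_
  have h₁ : g (M.toLin' x) = g₀ (M.toLin'.rangeRestrict x) :=
    LinearMap.congr_fun hg (M.toLin'.rangeRestrict x)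
  have h₂ := congrArg Subtype.val (LinearMap.congr_fun hg₀ (M.toLin'.rangeRestrict x))
  change M.toLin' (g (M.toLin' x)) = M.toLin' x
  rw [h₁]
  exact h₂

section MatrixUnits

variable {P Q I K R : Type*} [DecidableEq P] [DecidableEq Q] [Field K] [NonUnitalRing R]
  [Module K R] [IsScalarTower K R R] [SMulCommClass K R R] {c : P → I} {d : Q → I}
  {f : P → Q → R} {g : Q → P → R}

/-- The case of finitely many rows and columns of `exists_mul_mul_eq_self_of_mem_span`. -/
theorem exists_mul_mul_eq_self_of_fintype [Fintype P] [Fintype Q]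
    (h : ∀ p q q' p' p'' q'', c p = d q → d q' = c p' → c p'' = d q'' →
      f p q * g q' p' * f p'' q'' = if q = q' then if p' = p'' then f p q'' else 0 else 0)
    (M : P → Q → K) (hM : ∀ p q, M p q ≠ 0 → c p = d q) :
    ∃ y : R, (∑ p, ∑ q, M p q • f p q) * y * (∑ p, ∑ q, M p q • f p q) =
      ∑ p, ∑ q, M p q • f p q := by
  classical
  obtain ⟨N₀, hN₀⟩ := Matrix.exists_mul_mul_eq_self (Matrix.of M)
  -- The product rule says nothing about `g q p` outside the blocks, so the entries of `N₀` there
  -- are replaced by `0`; they do not contribute to `M * N₀ * M`.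
  let N : Q → P → K := fun q p => if d q = c p then N₀ q p else 0
  have hN : ∀ p q', ∑ q, ∑ p', M p q * N q p' * M p' q' = M p q' := by
    intro p q'
    by_cases hpq : c p = d q'
    · have : ∑ q, ∑ p', M p q * N₀ q p' * M p' q' = M p q' := by
        have := congrFun (congrFun hN₀ p) q'
        simp only [Matrix.mul_apply, Matrix.of_apply, Finset.sum_mul] at this
        rw [Finset.sum_comm, this]
      rw [← this]
      refine Finset.sum_congr rfl fun q _ => Finset.sum_congr rfl fun p' _ => ?_
      by_cases h₁ : M p q = 0
      · simp [h₁]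
      by_cases h₂ : M p' q' = 0
      · simp [h₂]
      simp only [N]
      rw [if_pos ((hM _ _ h₁).symm.trans (hpq.trans (hM _ _ h₂).symm))]
    · have h₀ : M p q' = 0 := by_contra fun h' => hpq (hM _ _ h')
      rw [h₀]
      refine Finset.sum_eq_zero fun q _ => Finset.sum_eq_zero fun p' _ => ?_
      by_contra hne
      have h₁ := hM _ _ (left_ne_zero_of_mul (left_ne_zero_of_mul hne))
      have h₂ := hM _ _ (right_ne_zero_of_mul hne)
      have h₃ : d q = c p' := by
        by_contra h₃
        exact right_ne_zero_of_mul (left_ne_zero_of_mul hne) (if_neg h₃)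
      exact hpq (h₁.trans (h₃.trans h₂))
  refine ⟨∑ q, ∑ p, N q p • g q p, ?_⟩
  have key : ∀ p q q' p' p'' q'',
      M p q • f p q * N q' p' • g q' p' * M p'' q'' • f p'' q'' =
        if q = q' then if p' = p'' then (M p q * N q p' * M p' q'') • f p q'' else 0 else 0 := by
    intro p q q' p' p'' q''
    rw [smul_mul_smul_comm, smul_mul_smul_comm]
    by_cases h₁ : M p q = 0
    · simp [h₁]
    by_cases h₂ : M p'' q'' = 0
    · simp only [h₂, mul_zero, zero_smul]
      split_ifs with _ h₃
      · rw [h₃, h₂, mul_zero, zero_smul]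
      · rfl
      · rfl
    by_cases h₃ : d q' = c p'
    · rw [h _ _ _ _ _ _ (hM _ _ h₁) h₃ (hM _ _ h₂)]
      split_ifs with h₄ h₅
      · rw [h₄, h₅]
      · rw [smul_zero]
      · rw [smul_zero]
    · have : N q' p' = 0 := if_neg h₃
      simp only [this, mul_zero, zero_mul, zero_smul]
      split_ifs with h₄ h₅
      · rw [h₄, this, mul_zero, zero_mul, zero_smul]
      · rfl
      · rfl
  calc _ = ∑ p, ∑ q, ∑ p'', ∑ q'', ∑ q', ∑ p',
        M p q • f p q * N q' p' • g q' p' * M p'' q'' • f p'' q'' := by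
        simp only [Finset.sum_mul (s := Finset.univ)]
        simp only [Finset.mul_sum, Finset.sum_mul]
    _ = ∑ p, ∑ q, ∑ p', ∑ q'', (M p q * N q p' * M p' q'') • f p q'' := by
        refine Finset.sum_congr rfl fun p _ => Finset.sum_congr rfl fun q _ =>
          Finset.sum_congr rfl fun p'' _ => Finset.sum_congr rfl fun q'' _ => ?_
        rw [Finset.sum_eq_single q (fun q' _ hq' => by simp [key, Ne.symm hq']) (by simp),
          Finset.sum_eq_single p'' (fun p' _ hp' => by simp [key, hp']) (by simp)]
        simp [key]
    _ = ∑ p, ∑ q'', ∑ q, ∑ p', (M p q * N q p' * M p' q'') • f p q'' := by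
        refine Finset.sum_congr rfl fun p _ => ?_
        rw [Finset.sum_congr rfl fun q _ => Finset.sum_comm, Finset.sum_comm]
    _ = _ := by simp only [← Finset.sum_smul, hN]

/-- Let `f p q` and `g q p`, for `p` and `q` in the same block, multiply like the matrix units of
a block matrix algebra. Then every linear combination `x` of the `f p q` is von
Neumann regular: its coefficients form a block matrix over a field, and a generalized inverse of
that matrix gives `y` with `x * y * x = x`. The functions `c` and `d` assign the blocks to the row
and column indices. -/
theorem exists_mul_mul_eq_self_of_mem_span
    (h : ∀ p q q' p' p'' q'', c p = d q → d q' = c p' → c p'' = d q'' →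
      f p q * g q' p' * f p'' q'' = if q = q' then if p' = p'' then f p q'' else 0 else 0)
    {x : R} (hx : x ∈ Submodule.span K {z | ∃ p q, c p = d q ∧ f p q = z}) :
    ∃ y : R, x * y * x = x := by
  have hset : {z | ∃ p q, c p = d q ∧ f p q = z} =
      (fun a : P × Q => f a.1 a.2) '' {a | c a.1 = d a.2} := by
    ext z; simp
  rw [hset, Finsupp.mem_span_image_iff_linearCombination] at hx
  obtain ⟨l, hl, rfl⟩ := hx
  let S := l.support.image Prod.fst
  let T := l.support.image Prod.snd
  have hsum : Finsupp.linearCombination K (fun a : P × Q => f a.1 a.2) l =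
      ∑ p : S, ∑ q : T, l (p.1, q.1) • f p q := by
    rw [Finset.sum_coe_sort S fun p => ∑ q : T, l (p, q.1) • f p q,
      Finset.sum_congr rfl fun p _ => Finset.sum_coe_sort T fun q => l (p, q) • f p q,
      ← Finset.sum_product' S T fun p q => l (p, q) • f p q,
      Finsupp.linearCombination_apply, Finsupp.sum]
    refine Finset.sum_subset Finset.subset_product fun a _ ha => ?_
    rw [Finsupp.notMem_support_iff.1 ha, zero_smul]
  rw [hsum]
  refine exists_mul_mul_eq_self_of_fintype (c := fun p : S => c p) (d := fun q : T => d q)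
    (f := fun p q => f p q) (g := fun q p => g q p) ?_ (fun p q => l (p.1, q.1)) ?_
  · intro p q q' p' p'' q'' h₁ h₂ h₃
    simp only [h _ _ _ _ _ _ h₁ h₂ h₃, Subtype.ext_iff]
  · intro p q hpq
    exact (Finsupp.mem_supported K l).1 hl (Finsupp.mem_support_iff.2 hpq)

end MatrixUnits

namespace LeavittPathAlgebra

variable {V A : Type*} (E : DirectedGraph V A) (K : Type*) [Field K]

/-! ### Vertices, edges and paths in the Leavitt path algebra -/

/-- The vertex `v` in `L_K(E)`. -/
noncomputable def vtx (v : V) : LeavittPathAlgebra E K := mk E K (vert K A v)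

/-- The edge `e` in `L_K(E)`. -/
noncomputable def edg (e : A) : LeavittPathAlgebra E K := mk E K (edge K V e)

/-- The ghost edge `e*` in `L_K(E)`. -/
noncomputable def gst (e : A) : LeavittPathAlgebra E K := mk E K (ghost K V e)

theorem vtx_mul_self (v : V) : vtx E K v * vtx E K v = vtx E K v :=
  mk_eq_of_rel E K (.vert_mul_self v)

theorem vtx_mul_vtx_of_ne {v w : V} (h : v ≠ w) : vtx E K v * vtx E K w = 0 :=
  mk_eq_of_rel E K (.vert_mul_vert v w h)

theorem vtx_mul_edg (e : A) : vtx E K (E.src e) * edg E K e = edg E K e :=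
  mk_eq_of_rel E K (.src_mul_edge e)

theorem edg_mul_vtx (e : A) : edg E K e * vtx E K (E.rng e) = edg E K e :=
  mk_eq_of_rel E K (.edge_mul_rng e)

theorem vtx_mul_gst (e : A) : vtx E K (E.rng e) * gst E K e = gst E K e :=
  mk_eq_of_rel E K (.rng_mul_ghost e)

theorem gst_mul_vtx (e : A) : gst E K e * vtx E K (E.src e) = gst E K e :=
  mk_eq_of_rel E K (.ghost_mul_src e)

theorem gst_mul_edg_self (e : A) : gst E K e * edg E K e = vtx E K (E.rng e) :=
  mk_eq_of_rel E K (.ghost_mul_edge_self e)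

theorem gst_mul_edg_of_ne {e f : A} (h : e ≠ f) : gst E K e * edg E K f = 0 :=
  mk_eq_of_rel E K (.ghost_mul_edge e f h)

theorem vtx_mul_edg_of_ne {v : V} {e : A} (h : v ≠ E.src e) : vtx E K v * edg E K e = 0 := by
  rw [← vtx_mul_edg, ← mul_assoc, vtx_mul_vtx_of_ne E K h, zero_mul]

theorem gst_mul_vtx_of_ne {v : V} {e : A} (h : E.src e ≠ v) : gst E K e * vtx E K v = 0 := by
  rw [← gst_mul_vtx, mul_assoc, vtx_mul_vtx_of_ne E K h, mul_zero]

/-- The source of a path with range `v`, given by its list of edges. -/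
def pathSource (v : V) : List A → V
  | [] => v
  | e :: _ => E.src e

/-- The list of edges `l` is a path with range `v`. The range is part of the data, so that the
empty list stands for the trivial path at `v`. -/
def IsPath (v : V) : List A → Prop
  | [] => True
  | e :: l => E.rng e = pathSource E v l ∧ IsPath v l

/-- The path `l` with range `v` as an element of `L_K(E)`. -/
noncomputable def pathElt (v : V) : List A → LeavittPathAlgebra E K
  | [] => vtx E K v
  | e :: l => edg E K e * pathElt v l

/-- The ghost path `l*`, for a path `l` with range `v`, as an element of `L_K(E)`. -/
noncomputable def ghostElt (v : V) : List A → LeavittPathAlgebra E K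
  | [] => vtx E K v
  | e :: l => ghostElt v l * gst E K e

theorem vtx_mul_pathElt (v : V) (l : List A) :
    vtx E K (pathSource E v l) * pathElt E K v l = pathElt E K v l := by
  cases l with
  | nil => exact vtx_mul_self E K v
  | cons e l => rw [pathElt, pathSource, ← mul_assoc, vtx_mul_edg]

theorem ghostElt_mul_vtx (v : V) (l : List A) :
    ghostElt E K v l * vtx E K (pathSource E v l) = ghostElt E K v l := by
  cases l with
  | nil => exact vtx_mul_self E K v
  | cons e l => rw [ghostElt, pathSource, mul_assoc, gst_mul_vtx]

theorem pathElt_mul_vtx (v : V) (l : List A) :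
    pathElt E K v l * vtx E K v = pathElt E K v l := by
  induction l with
  | nil => exact vtx_mul_self E K v
  | cons e l ih => rw [pathElt, mul_assoc, ih]

theorem vtx_mul_ghostElt (v : V) (l : List A) :
    vtx E K v * ghostElt E K v l = ghostElt E K v l := by
  induction l with
  | nil => exact vtx_mul_self E K v
  | cons e l ih => rw [ghostElt, ← mul_assoc, ih]

theorem vtx_mul_pathElt_of_ne {u v : V} {l : List A} (h : u ≠ pathSource E v l) :
    vtx E K u * pathElt E K v l = 0 := by
  rw [← vtx_mul_pathElt, ← mul_assoc, vtx_mul_vtx_of_ne E K h, zero_mul]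

theorem pathSource_concat (l : List A) (e : A) :
    pathSource E (E.rng e) (l ++ [e]) = pathSource E (E.src e) l := by
  cases l <;> rfl

theorem IsPath.concat {l : List A} {e : A} (h : IsPath E (E.src e) l) :
    IsPath E (E.rng e) (l ++ [e]) := by
  induction l with
  | nil => exact ⟨rfl, trivial⟩
  | cons f l ih => exact ⟨h.1.trans (pathSource_concat E l e).symm, ih h.2⟩

theorem pathElt_concat (l : List A) (e : A) :
    pathElt E K (E.rng e) (l ++ [e]) = pathElt E K (E.src e) l * edg E K e := by
  induction l with
  | nil => exact (edg_mul_vtx E K e).trans (vtx_mul_edg E K e).symm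
  | cons f l ih => rw [List.cons_append, pathElt, ih, pathElt, mul_assoc]

theorem ghostElt_concat (l : List A) (e : A) :
    ghostElt E K (E.rng e) (l ++ [e]) = gst E K e * ghostElt E K (E.src e) l := by
  induction l with
  | nil => exact (vtx_mul_gst E K e).trans (gst_mul_vtx E K e).symm
  | cons f l ih => rw [List.cons_append, ghostElt, ih, ghostElt, mul_assoc]

/-! ### Monomials -/

/-- `x` is a monomial `α β*` of degree `k`, where `α` and `β` are paths with the same range. -/
def IsMonomial (k : ℤ) (x : LeavittPathAlgebra E K) : Prop :=
  ∃ (v : V) (α β : List A), IsPath E v α ∧ IsPath E v β ∧ (α.length : ℤ) = β.length + k ∧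
    x = pathElt E K v α * ghostElt E K v β

/-- A generator times a monomial is zero or a monomial. -/
theorem IsMonomial.generator_mul {k : ℤ} {x : LeavittPathAlgebra E K} (hx : IsMonomial E K k x)
    (g : Generator V A) :
    mk E K (word K (FreeSemigroup.of g)) * x = 0 ∨
      IsMonomial E K (g.degree + k) (mk E K (word K (FreeSemigroup.of g)) * x) := by
  obtain ⟨v, α, β, hα, hβ, hk, rfl⟩ := hx
  rw [← mul_assoc]
  cases g with
  | vertex u =>
    change vtx E K u * _ * _ = 0 ∨ IsMonomial E K _ (vtx E K u * _ * _)
    by_cases hu : u = pathSource E v α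
    · rw [hu, vtx_mul_pathElt]
      exact .inr ⟨v, α, β, hα, hβ, by simpa [Generator.degree] using hk, rfl⟩
    · exact .inl (by rw [vtx_mul_pathElt_of_ne E K hu, zero_mul])
  | edge e =>
    change edg E K e * _ * _ = 0 ∨ IsMonomial E K _ (edg E K e * _ * _)
    by_cases he : E.rng e = pathSource E v α
    · refine .inr ⟨v, e :: α, β, ⟨he, hα⟩, hβ, ?_, rfl⟩
      simp only [Generator.degree, List.length_cons]; omega
    · left
      rw [← edg_mul_vtx, mul_assoc (edg E K e), vtx_mul_pathElt_of_ne E K he, mul_zero, zero_mul]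
  | ghost e =>
    change gst E K e * _ * _ = 0 ∨ IsMonomial E K _ (gst E K e * _ * _)
    cases α with
    | nil =>
      rw [pathElt, mul_assoc, vtx_mul_ghostElt]
      by_cases he : E.src e = v
      · subst he
        refine .inr ⟨E.rng e, [], β ++ [e], trivial, hβ.concat E, ?_, ?_⟩
        · simp only [Generator.degree, List.length_nil, List.length_append,
            List.length_singleton] at hk ⊢
          push_cast at hk ⊢
          omega
        · rw [ghostElt_concat, pathElt, ← mul_assoc, vtx_mul_gst]
      · left
        rw [← vtx_mul_ghostElt, ← mul_assoc, gst_mul_vtx_of_ne E K he, zero_mul]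
    | cons f α =>
      rw [pathElt, ← mul_assoc (gst E K e)]
      by_cases he : e = f
      · subst he
        rw [gst_mul_edg_self, hα.1, vtx_mul_pathElt]
        refine .inr ⟨v, α, β, hα.2, hβ, ?_, rfl⟩
        simp only [Generator.degree, List.length_cons] at hk ⊢; omega
      · exact .inl (by rw [gst_mul_edg_of_ne E K he, zero_mul, zero_mul])

theorem mk_word_eq_zero_or_isMonomial (w : FreeSemigroup (Generator V A)) :
    mk E K (word K w) = 0 ∨ IsMonomial E K (wordDegree w) (mk E K (word K w)) := by
  induction w using FreeSemigroup.recOnMul with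
  | ih1 g =>
    right
    cases g with
    | vertex v =>
      exact ⟨v, [], [], trivial, trivial, rfl, (vtx_mul_self E K v).symm⟩
    | edge e =>
      refine ⟨E.rng e, [e], [], ⟨rfl, trivial⟩, trivial, rfl, ?_⟩
      rw [pathElt, pathElt, ghostElt, edg_mul_vtx, edg_mul_vtx]; rfl
    | ghost e =>
      refine ⟨E.rng e, [], [e], trivial, ⟨rfl, trivial⟩, rfl, ?_⟩
      rw [ghostElt, ghostElt, pathElt, vtx_mul_gst, vtx_mul_gst]; rfl
  | ih2 g w _ hw =>
    rw [← word_mul_word, mk_mul, wordDegree_mul]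
    rcases hw with hw | hw
    · exact .inl (by rw [hw, mul_zero])
    · exact hw.generator_mul E K g

/-! ### Matrix units in the Leavitt path algebra -/

open Classical in
/-- The idempotent `v - ∑ e e*`, where `e` runs through the edges in `F` that `v` emits. -/
noncomputable def gap (F : Finset A) (v : V) : LeavittPathAlgebra E K :=
  vtx E K v - ∑ e ∈ F with E.src e = v, edg E K e * gst E K e

theorem vtx_mul_gap (F : Finset A) (v : V) : vtx E K v * gap E K F v = gap E K F v := by
  classical
  rw [gap, mul_sub, vtx_mul_self, Finset.mul_sum]
  congr 1
  refine Finset.sum_congr rfl fun e he => ?_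
  rw [← (Finset.mem_filter.1 he).2, ← mul_assoc, vtx_mul_edg]

theorem gap_mul_vtx (F : Finset A) (v : V) : gap E K F v * vtx E K v = gap E K F v := by
  classical
  rw [gap, sub_mul, vtx_mul_self, Finset.sum_mul]
  congr 1
  refine Finset.sum_congr rfl fun e he => ?_
  rw [← (Finset.mem_filter.1 he).2, mul_assoc, gst_mul_vtx]

theorem gap_mul_edg {F : Finset A} {e : A} (he : e ∈ F) (v : V) :
    gap E K F v * edg E K e = 0 := by
  classical
  rw [gap, sub_mul, Finset.sum_mul]
  by_cases hv : E.src e = v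
  · subst hv
    rw [Finset.sum_eq_single e]
    · rw [mul_assoc, gst_mul_edg_self, edg_mul_vtx, vtx_mul_edg, sub_self]
    · intro f _ hf
      rw [mul_assoc, gst_mul_edg_of_ne E K hf, mul_zero]
    · simp [he]
  · rw [vtx_mul_edg_of_ne E K (Ne.symm hv), Finset.sum_eq_zero, sub_zero]
    intro f hf
    rw [mul_assoc, gst_mul_edg_of_ne E K, mul_zero]
    rintro rfl
    exact hv (Finset.mem_filter.1 hf).2

theorem gst_mul_gap {F : Finset A} {e : A} (he : e ∈ F) (v : V) :
    gst E K e * gap E K F v = 0 := by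
  classical
  rw [gap, mul_sub, Finset.mul_sum]
  by_cases hv : E.src e = v
  · subst hv
    rw [Finset.sum_eq_single e]
    · rw [← mul_assoc, gst_mul_edg_self, vtx_mul_gst, gst_mul_vtx, sub_self]
    · intro f _ hf
      rw [← mul_assoc, gst_mul_edg_of_ne E K (Ne.symm hf), zero_mul]
    · simp [he]
  · rw [gst_mul_vtx_of_ne E K hv, Finset.sum_eq_zero, sub_zero]
    intro f hf
    rw [← mul_assoc, gst_mul_edg_of_ne E K, zero_mul]
    rintro rfl
    exact hv (Finset.mem_filter.1 hf).2

theorem gap_mul_self (F : Finset A) (v : V) : gap E K F v * gap E K F v = gap E K F v := by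
  classical
  nth_rewrite 1 [gap]
  rw [sub_mul, vtx_mul_gap, Finset.sum_mul, Finset.sum_eq_zero, sub_zero]
  intro e he
  rw [mul_assoc, gst_mul_gap E K (Finset.mem_filter.1 he).1, mul_zero]

/-- The idempotent in the middle of the matrix units of level `i.1` at the vertex `i.2`: paths of
length below the bound `n` can still be extended by edges in `F`, and the
idempotents `e e*` of these extensions are subtracted; for paths of length `n` nothing is removed. -/
noncomputable def core (F : Finset A) (n : ℤ) (i : ℤ × V) : LeavittPathAlgebra E K :=
  if i.1 < n then gap E K F i.2 else vtx E K i.2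

theorem core_of_lt (F : Finset A) {n : ℤ} {i : ℤ × V} (h : i.1 < n) :
    core E K F n i = gap E K F i.2 := if_pos h

theorem core_mul_self (F : Finset A) (n : ℤ) (i : ℤ × V) :
    core E K F n i * core E K F n i = core E K F n i := by
  unfold core
  split_ifs
  exacts [gap_mul_self E K F _, vtx_mul_self E K _]

theorem core_mul_vtx (F : Finset A) (n : ℤ) (i : ℤ × V) :
    core E K F n i * vtx E K i.2 = core E K F n i := by
  unfold core
  split_ifs
  exacts [gap_mul_vtx E K F _, vtx_mul_self E K _]

open Classical in
/-- The orthogonality relations behind the matrix units. If one of the paths `β`, `γ` properly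
extends the other, then the shorter one has a level below `n`, and its idempotent `core` kills the
next edge of the longer one. -/
theorem core_mul_ghostElt_mul_pathElt_mul_core {F : Finset A} {n : ℤ} {v w : V} {β γ : List A}
    (hβ : IsPath E v β) (hγ : IsPath E w γ) (hβF : ∀ e ∈ β, e ∈ F) (hγF : ∀ e ∈ γ, e ∈ F)
    (s : ℤ) (hβn : β.length + s ≤ n) (hγn : γ.length + s ≤ n) :
    core E K F n (β.length + s, v) * (ghostElt E K v β * pathElt E K w γ) *
        core E K F n (γ.length + s, w) =
      if β = γ ∧ v = w then core E K F n (β.length + s, v) else 0 := by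
  induction β generalizing γ s with
  | nil =>
    cases γ with
    | nil =>
      by_cases hvw : v = w
      · subst hvw
        simp only [ghostElt, pathElt, and_self, if_true]
        rw [vtx_mul_self, core_mul_vtx E K F n (_, v), core_mul_self]
      · rw [if_neg fun h => hvw h.2, ghostElt, pathElt, vtx_mul_vtx_of_ne E K hvw, mul_zero,
          zero_mul]
    | cons f γ =>
      simp only [List.length_cons, List.length_nil] at hγn ⊢
      rw [if_neg fun h => List.cons_ne_nil _ _ h.1.symm,
        core_of_lt E K F (i := (_, v)) (by push_cast at hγn ⊢; omega), ghostElt, pathElt,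
        ← mul_assoc, gap_mul_vtx, ← mul_assoc, gap_mul_edg E K (hγF f (by simp)), zero_mul, zero_mul]
  | cons e β ih =>
    cases γ with
    | nil =>
      simp only [List.length_cons, List.length_nil] at hβn ⊢
      rw [if_neg fun h => List.cons_ne_nil _ _ h.1,
        core_of_lt E K F (i := (_, w)) (by push_cast at hβn ⊢; omega), ghostElt, pathElt,
        mul_assoc, mul_assoc, vtx_mul_gap, mul_assoc, gst_mul_gap E K (hβF e (by simp)), mul_zero,
        mul_zero]
    | cons f γ =>
      rw [ghostElt, pathElt, mul_assoc (ghostElt E K v β), ← mul_assoc (gst E K e)]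
      by_cases hef : e = f
      · subst hef
        have hlen : ∀ l : List A, ((e :: l).length : ℤ) + s = l.length + (s + 1) := fun l => by
          rw [List.length_cons]; push_cast; ring
        rw [gst_mul_edg_self, ← mul_assoc (ghostElt E K v β), hβ.1, ghostElt_mul_vtx, hlen, hlen,
          ih hβ.2 hγ.2 (fun e he => hβF e (List.mem_cons_of_mem _ he))
            (fun e he => hγF e (List.mem_cons_of_mem _ he)) (s + 1) (hlen β ▸ hβn) (hlen γ ▸ hγn)]
        simp
      · rw [if_neg fun h => hef (List.cons.inj h.1).1, gst_mul_edg_of_ne E K hef]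
        simp

/-- The paths (list of edges, range) with edges in `F` whose level, the length plus the shift `s`,
is at most `n`. -/
abbrev BoundedPath (F : Finset A) (n s : ℤ) : Type _ :=
  {p : List A × V // IsPath E p.2 p.1 ∧ (∀ e ∈ p.1, e ∈ F) ∧ p.1.length + s ≤ n}

variable {E} in
/-- The block of a path: its level and its range. -/
def BoundedPath.block {F : Finset A} {n s : ℤ} (p : BoundedPath E F n s) : ℤ × V :=
  (p.1.1.length + s, p.1.2)

/-- The element `α q β*` of `L_K(E)`, for paths `α = p` and `β = p'` (lists of edges with range)
and the idempotent `q` of the block `i`. -/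
noncomputable def unitElt (F : Finset A) (n : ℤ) (p : List A × V) (i : ℤ × V) (p' : List A × V) :
    LeavittPathAlgebra E K :=
  pathElt E K p.2 p.1 * core E K F n i * ghostElt E K p'.2 p'.1

open Classical in
theorem unitElt_mul_unitElt {F : Finset A} {n s : ℤ} (p p' : List A × V)
    (q q' : BoundedPath E F n s) :
    unitElt E K F n p q.block q.1 * unitElt E K F n q'.1 q'.block p' =
      if q = q' then unitElt E K F n p q.block p' else 0 := by
  obtain ⟨⟨β, v⟩, hβ, hβF, hβn⟩ := q
  obtain ⟨⟨γ, w⟩, hγ, hγF, hγn⟩ := q'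
  have := core_mul_ghostElt_mul_pathElt_mul_core E K hβ hγ hβF hγF s hβn hγn
  have h : unitElt E K F n p (β.length + s, v) (β, v) *
      unitElt E K F n (γ, w) (γ.length + s, w) p' =
      pathElt E K p.2 p.1 * (core E K F n (β.length + s, v) *
        (ghostElt E K v β * pathElt E K w γ) * core E K F n (γ.length + s, w)) *
        ghostElt E K p'.2 p'.1 := by
    simp only [unitElt, mul_assoc]
  refine h.trans ?_
  rw [this]
  simp only [BoundedPath.block, Subtype.mk.injEq, Prod.mk.injEq]
  split_ifs
  · rfl
  · simp

/-- The span of the matrix units of degree `k` that use edges in `F` and are bounded by `n`. -/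
noncomputable def unitSpan (F : Finset A) (n k : ℤ) : Submodule K (LeavittPathAlgebra E K) :=
  Submodule.span K {z | ∃ (p : BoundedPath E F n (-k)) (q : BoundedPath E F n 0),
    p.block = q.block ∧ unitElt E K F n p.1 p.block q.1 = z}

theorem exists_mul_mul_eq_self_of_mem_unitSpan {F : Finset A} {n k : ℤ}
    {x : LeavittPathAlgebra E K} (hx : x ∈ unitSpan E K F n k) : ∃ y, x * y * x = x := by
  classical
  refine exists_mul_mul_eq_self_of_mem_span (K := K)
    (c := fun p : BoundedPath E F n (-k) => p.block) (d := fun q : BoundedPath E F n 0 => q.block)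
    (f := fun p q => unitElt E K F n p.1 p.block q.1)
    (g := fun q p => unitElt E K F n q.1 q.block p.1) ?_ hx
  intro p q q' p' p'' q'' h₁ h₂ _
  rw [h₁, unitElt_mul_unitElt]
  split_ifs with hq hp
  · subst hq hp
    rw [h₂, unitElt_mul_unitElt, if_pos rfl]
  · subst hq
    rw [h₂, unitElt_mul_unitElt, if_neg hp]
  · rw [zero_mul]

/-- Every monomial `α β*` with edges in `F` is a combination of matrix units: as long as `β` is
shorter than `n`, write `α β* = α (v - ∑ e e*) β* + ∑ (α e) (β e)*`. -/
theorem pathElt_mul_ghostElt_mem_unitSpan {F : Finset A} {n : ℕ} {k : ℤ} {v : V} {α β : List A}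
    (hα : IsPath E v α) (hβ : IsPath E v β) (hαF : ∀ e ∈ α, e ∈ F) (hβF : ∀ e ∈ β, e ∈ F)
    (hk : (α.length : ℤ) = β.length + k) (hn : β.length ≤ n) :
    pathElt E K v α * ghostElt E K v β ∈ unitSpan E K F n k := by
  classical
  induction hm : n - β.length generalizing v α β with
  | zero =>
    refine Submodule.subset_span ⟨⟨(α, v), hα, hαF, by simp only; omega⟩,
      ⟨(β, v), hβ, hβF, by simp only; omega⟩,
      Prod.ext (by simp only [BoundedPath.block]; omega) rfl, ?_⟩
    rw [unitElt, core, if_neg (by simp only [BoundedPath.block]; omega)]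
    simp only [BoundedPath.block, pathElt_mul_vtx]
  | succ m ih =>
    have hsplit : pathElt E K v α * ghostElt E K v β =
        pathElt E K v α * gap E K F v * ghostElt E K v β +
        ∑ e ∈ F with E.src e = v, pathElt E K v α * edg E K e * (gst E K e * ghostElt E K v β) := by
      rw [gap, mul_sub, sub_mul, pathElt_mul_vtx, Finset.mul_sum, Finset.sum_mul]
      simp only [mul_assoc, sub_add_cancel]
    rw [hsplit]
    refine Submodule.add_mem _ ?_ (Submodule.sum_mem _ fun e he => ?_)
    · refine Submodule.subset_span ⟨⟨(α, v), hα, hαF, by simp only; omega⟩,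
        ⟨(β, v), hβ, hβF, by simp only; omega⟩,
        Prod.ext (by simp only [BoundedPath.block]; omega) rfl, ?_⟩
      rw [unitElt, core_of_lt E K F (by simp only [BoundedPath.block]; omega)]
      rfl
    · obtain ⟨heF, rfl⟩ := Finset.mem_filter.1 he
      rw [← pathElt_concat, ← ghostElt_concat]
      refine ih (hα.concat E) (hβ.concat E) ?_ ?_ ?_ ?_ ?_
      · simp only [List.mem_append, List.mem_singleton]
        rintro f (hf | rfl)
        exacts [hαF f hf, heF]
      · simp only [List.mem_append, List.mem_singleton]
        rintro f (hf | rfl)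
        exacts [hβF f hf, heF]
      all_goals simp only [List.length_append, List.length_singleton]; omega

/-! ### Graded von Neumann regularity -/

/-- A homogeneous element is a combination of finitely many monomials, so that finitely many edges
and a common length bound suffice for it. -/
theorem exists_mem_unitSpan {k : ℤ} {x : LeavittPathAlgebra E K} (hx : x ∈ component E K k) :
    ∃ (F : Finset A) (n : ℕ), x ∈ unitSpan E K F n k := by
  classical
  suffices ∃ (F₀ : Finset A) (n₀ : ℕ), ∀ F n, F₀ ⊆ F → n₀ ≤ n → x ∈ unitSpan E K F (n : ℕ) k by
    obtain ⟨F, n, h⟩ := this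
    exact ⟨F, n, h F n subset_rfl le_rfl⟩
  induction hx using Submodule.span_induction with
  | zero => exact ⟨∅, 0, fun _ _ _ _ => Submodule.zero_mem _⟩
  | add x y _ _ hx hy =>
    obtain ⟨F₁, n₁, h₁⟩ := hx
    obtain ⟨F₂, n₂, h₂⟩ := hy
    exact ⟨F₁ ∪ F₂, max n₁ n₂, fun F n hF hn => Submodule.add_mem _
      (h₁ F n (Finset.union_subset_left hF) (le_of_max_le_left hn))
      (h₂ F n (Finset.union_subset_right hF) (le_of_max_le_right hn))⟩
  | smul c x _ hx =>
    obtain ⟨F₁, n₁, h₁⟩ := hx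
    exact ⟨F₁, n₁, fun F n hF hn => Submodule.smul_mem _ c (h₁ F n hF hn)⟩
  | mem x hx =>
    obtain ⟨w, rfl, rfl⟩ := hx
    rcases mk_word_eq_zero_or_isMonomial E K w with h | ⟨v, α, β, hα, hβ, hk, h⟩
    · exact ⟨∅, 0, fun _ _ _ _ => h ▸ Submodule.zero_mem _⟩
    · rw [h]
      exact ⟨(α ++ β).toFinset, β.length, fun F n hF hn =>
        pathElt_mul_ghostElt_mem_unitSpan E K hα hβ (fun e he => hF (by simp [he]))
          (fun e he => hF (by simp [he])) hk hn⟩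

end LeavittPathAlgebra

theorem theorem2 {V A : Type*} (E : DirectedGraph V A) (K : Type*) [Field K] :
    IsGradedVonNeumannRegular (LeavittPathAlgebra.component E K) := by
  refine { LeavittPathAlgebra.isRingGrading_component E K with regular := fun k x hx => ?_ }
  obtain ⟨F, n, h⟩ := LeavittPathAlgebra.exists_mem_unitSpan E K hx
  exact LeavittPathAlgebra.exists_mul_mul_eq_self_of_mem_unitSpan E K h
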